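/- For a finite set $S \subset \mathbb{C}[x]$ and an integer $m \geq 1$ write $S^m = \{s_1 s_2 \cdots s_m : s_1, \ldots, s_m \in S\}$ for the $m$-fold product set and $mS = \{s_1 + s_2 + \cdots + s_m : s_1, \ldots, s_m \in S\}$ for the $m$-fold sumset. There is a real-valued function $f(c,k,\ell)$, defined for real $c \geq 1$ and integers $k, \ell \geq 1$, such that for every fixed $c$ and $k$ we have $f(c,k,\ell) \to 0$ as $\ell \to \infty$, and such that the following holds. Given a real $c \geq 1$ and integers $k, \ell \geq 1$, there is an $N = N(c,k,\ell)$ such that for all $n \geq N$: if $S$ is a set of $n$ polynomials in $\mathbb{C}[x]$, no one of which is a scalar multiple (by an element of $\mathbb{C}$) of another, and $$|S^\ell| < n^c,$$ then $$|kS| > n^{k - f(c,k,\ell)}.$$ -/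

import Mathlib

open Filter Topology Polynomial

open Classical in
/-- The `l`-fold product set `S ^ l = S.S...S`, that is `{s₁ * ⋯ * s_l : s₁, …, s_l ∈ S}`. -/
noncomputable def prodSet {R : Type*} [CommRing R] (l : ℕ) (S : Finset R) : Finset R :=
  (Fintype.piFinset fun _ : Fin l => S).image fun s => ∏ i, s i

open Classical in
/-- The `k`-fold sumset `kS = S + ⋯ + S`, that is `{s₁ + ⋯ + s_k : s₁, …, s_k ∈ S}`
(not the dilate `{k * s : s ∈ S}`). -/
noncomputable def sumSet {R : Type*} [CommRing R] (k : ℕ) (S : Finset R) : Finset R :=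
  (Fintype.piFinset fun _ : Fin k => S).image fun s => ∑ i, s i

/-- No element of `S` is a (complex) scalar multiple of another element of `S`. -/
def NoScalarMultiples (S : Finset ℂ[X]) : Prop :=
  ∀ p ∈ S, ∀ q ∈ S, p ≠ q → ∀ a : ℂ, p ≠ a • q

/-! Divisors turn products into sums in a torsion-free group, where `S` embeds because it has no
proportional pairs. Along the scales `A ^ (m + 1) ^ j` some step grows by at most `n ^ (c / J)`.
There Ruzsa covering, applied to a power of `A` and its set of `m`-th powers, puts `A` in at most `n
^ (c / J)` classes modulo `m`-th powers (`exists_subset_eq_mul_pow`). A most popular class gives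
many elements of `S` of the form constant times `g * r ^ m`, with `g` common.

A Wronskian argument in the style of Mason's theorem shows that few pairwise non-proportional
polynomials have independent `m`-th powers once `m` is large
(`linearIndependent_pow_of_pairwise_ne_C_mul`). With `m = (2k)²`, any `2k` elements of the class are
independent, so its `k`-subsets have distinct sums, and there are about `n ^ k` of them up to a
small loss in the exponent. -/

/-! ### Slow growth and classes modulo `m`-th powers. -/

section PowerClasses

open scoped Pointwise

variable {G : Type*} [CommGroup G] [DecidableEq G]

/-- Slow growth of the powers of `A` forces one step of multiplicative factor at most `|A| ^ (c / J)`. -/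
theorem exists_card_pow_step_le {A : Finset G} (hA : A.Nonempty) {q J l : ℕ} {c : ℝ}
    (hq : 1 ≤ q) (hJ : 1 ≤ J) (hl : q ^ J ≤ l) (h : ((A ^ l).card : ℝ) < (A.card : ℝ) ^ c) :
    ∃ j, ((A ^ q ^ (j + 1)).card : ℝ) ≤ (A.card : ℝ) ^ (c / J) * ((A ^ q ^ j).card : ℝ) := by
  by_contra! hcon
  have hn : (0 : ℝ) < A.card := by exact_mod_cast hA.card_pos
  have key : ∀ j : ℕ, ((A.card : ℝ) ^ (c / J)) ^ j ≤ ((A ^ q ^ j).card : ℝ) := by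
    intro j
    induction j with
    | zero => simpa using hA.card_pos
    | succ j ih =>
      refine le_trans ?_ (hcon j).le
      rw [pow_succ']
      exact mul_le_mul_of_nonneg_left ih (by positivity)
  have h1 := key J
  have hJ' : (J : ℝ) ≠ 0 := by positivity
  rw [← Real.rpow_natCast, ← Real.rpow_mul hn.le, div_mul_cancel₀ _ hJ'] at h1
  have h2 : (A ^ q ^ J).card ≤ (A ^ l).card :=
    Finset.card_pow_mono (pow_pos hq J).ne' hl
  have h3 : ((A ^ q ^ J).card : ℝ) ≤ (A ^ l).card := by exact_mod_cast h2
  linarith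

/-- A set whose powers grow slowly has a large subset inside one class modulo `m`-th powers. -/
theorem exists_subset_eq_mul_pow [IsMulTorsionFree G] {A : Finset G} (hA : A.Nonempty)
    {m J l : ℕ} {c : ℝ} (hm : 1 ≤ m) (hJ : 1 ≤ J) (hl : (m + 1) ^ J ≤ l)
    (h : ((A ^ l).card : ℝ) < (A.card : ℝ) ^ c) :
    ∃ B ⊆ A, (A.card : ℝ) ^ (1 - c / J) ≤ (B.card : ℝ) ∧
      ∀ a ∈ B, ∀ b ∈ B, ∃ r : G, a = b * r ^ m := by
  obtain ⟨j, hj⟩ := exists_card_pow_step_le hA (Nat.succ_pos m) hJ hl h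
  have hn : (0 : ℝ) < A.card := by exact_mod_cast hA.card_pos
  set M := (m + 1) ^ j with hM
  have hM1 : 1 ≤ M := Nat.one_le_pow _ _ (Nat.succ_pos m)
  set T := A ^ M with hT
  set P := T.image (fun t => t ^ m) with hP
  have hTne : T.Nonempty := hA.pow
  have hPcard : P.card = T.card :=
    Finset.card_image_of_injective _ (pow_left_injective (by omega))
  -- Thus `T * P` lies in the next scale, while torsion-freeness keeps `P` as large as `T`.
  have hPsub : P ⊆ T ^ m := by
    intro x hx
    obtain ⟨t, ht, rfl⟩ := Finset.mem_image.1 hx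
    exact Finset.pow_mem_pow ht
  have hTP : ((T * P).card : ℝ) ≤ (A.card : ℝ) ^ (c / J) * (P.card : ℝ) := by
    rw [hPcard]
    refine le_trans ?_ hj
    have : T * P ⊆ A ^ (m + 1) ^ (j + 1) := by
      rw [pow_succ (m + 1) j, pow_mul, pow_succ']
      exact Finset.mul_subset_mul_left hPsub
    exact_mod_cast Finset.card_le_card this
  obtain ⟨F, -, hFcard, hcov⟩ := Finset.ruzsa_covering_mul (hTne.image _) hTP
  obtain ⟨a₀, ha₀⟩ := hA
  -- Padding by the fixed `a₀ ^ (M - 1)` moves `a` into `T`; it cancels when two elements are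
  -- compared.
  have hmem : ∀ a ∈ A, ∃ x ∈ F, ∃ r : G, a * a₀ ^ (M - 1) = x * r ^ m := by
    intro a ha
    have h1 : a * a₀ ^ (M - 1) ∈ T := by
      have : A ^ M = A * A ^ (M - 1) := by rw [← pow_succ', Nat.sub_add_cancel hM1]
      rw [hT, this]
      exact Finset.mul_mem_mul ha (Finset.pow_mem_pow ha₀)
    obtain ⟨x, hx, y, hy, hxy⟩ := Finset.mem_mul.1 (hcov h1)
    obtain ⟨u, hu, v, hv, rfl⟩ := Finset.mem_div.1 hy
    obtain ⟨u, -, rfl⟩ := Finset.mem_image.1 hu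
    obtain ⟨v, -, rfl⟩ := Finset.mem_image.1 hv
    exact ⟨x, hx, u / v, by rw [← hxy, div_pow]⟩
  choose! φ hφF r hr using hmem
  have hFne : F.Nonempty := ⟨_, hφF a₀ ha₀⟩
  have hFpos : (0 : ℝ) < F.card := by exact_mod_cast hFne.card_pos
  obtain ⟨x, -, hx⟩ := Finset.exists_le_card_fiber_of_nsmul_le_card_of_maps_to
    (b := (A.card : ℝ) / F.card) hφF hFne (by rw [nsmul_eq_mul]; field_simp; rfl)
  refine ⟨A.filter (fun a => φ a = x), Finset.filter_subset _ _, le_trans ?_ hx, ?_⟩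
  · rw [Real.rpow_sub hn, Real.rpow_one]
    gcongr
  · intro a ha b hb
    obtain ⟨ha, hax⟩ := Finset.mem_filter.1 ha
    obtain ⟨hb, hbx⟩ := Finset.mem_filter.1 hb
    refine ⟨r a / r b, ?_⟩
    have h1 := hr a ha
    have h2 := hr b hb
    rw [hax] at h1
    rw [hbx] at h2
    apply mul_right_cancel (b := a₀ ^ (M - 1) * r b ^ m)
    calc a * (a₀ ^ (M - 1) * r b ^ m) = (x * r b ^ m) * r a ^ m := by
          rw [← mul_assoc, h1, mul_right_comm]
      _ = b * (r a / r b) ^ m * (a₀ ^ (M - 1) * r b ^ m) := by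
          rw [← h2, div_pow, mul_assoc b, mul_assoc b, mul_comm (r a ^ m / _), mul_assoc (a₀ ^ _),
            mul_div_cancel]

end PowerClasses

/-! ### Wronskians of polynomials and of their powers. -/

section Wronskian

variable {K : Type*} [Field K]

/-- The Wronskian matrix of a family of polynomials. -/
noncomputable def wronskianMatrix {n : ℕ} (f : Fin n → K[X]) : Matrix (Fin n) (Fin n) K[X] :=
  Matrix.of fun j i => derivative^[j] (f i)

theorem exists_eq_C_mul_of_mul_derivative_eq [CharZero K] {p q : K[X]} (hp : p ≠ 0)
    (h : p * derivative q = derivative p * q) : ∃ a : K, q = C a * p := by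
  classical
  set d := EuclideanDomain.gcd p q with hd
  have hd0 : d ≠ 0 := fun h0 => hp (EuclideanDomain.gcd_eq_zero_iff.1 h0).1
  obtain ⟨p', hp'⟩ : d ∣ p := EuclideanDomain.gcd_dvd_left p q
  obtain ⟨q', hq'⟩ : d ∣ q := EuclideanDomain.gcd_dvd_right p q
  have hcop : IsCoprime p' q' := by
    refine ⟨EuclideanDomain.gcdA p q, EuclideanDomain.gcdB p q, mul_left_cancel₀ hd0 ?_⟩
    have := EuclideanDomain.gcd_eq_gcd_ab p q
    rw [← hd] at this
    linear_combination (-EuclideanDomain.gcdA p q) * hp' - EuclideanDomain.gcdB p q * hq' -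
      this
  have hw : wronskian p' q' = 0 := by
    have : d * d * wronskian p' q' = 0 := by
      rw [hp', hq'] at h
      simp only [derivative_mul] at h
      rw [wronskian]
      linear_combination h
    simpa [hd0] using this
  obtain ⟨h1, h2⟩ := hcop.wronskian_eq_zero_iff.1 hw
  obtain ⟨a, ha⟩ := natDegree_eq_zero.1 (derivative_eq_zero.1 h1)
  obtain ⟨b, hb⟩ := natDegree_eq_zero.1 (derivative_eq_zero.1 h2)
  have ha0 : a ≠ 0 := by
    rintro rfl
    apply hp
    rw [hp', ← ha]
    simp
  refine ⟨b / a, ?_⟩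
  rw [hq', hp', ← ha, ← hb, mul_left_comm, ← C_mul, div_mul_cancel₀ _ ha0]

/-- A kernel vector `g` with `g k ≠ 0` can be differentiated and recombined to kill its `k`-th
entry. By induction the other entries vanish too, so every `g i / g k` has zero derivative and is
constant: a relation over `K`. -/
theorem det_wronskianMatrix_ne_zero [CharZero K] {n : ℕ} {f : Fin n → K[X]}
    (hf : LinearIndependent K f) : (wronskianMatrix f).det ≠ 0 := by
  induction n with
  | zero => simp
  | succ n ih =>
    intro hdet
    obtain ⟨g, hg0, hg⟩ := Matrix.exists_mulVec_eq_zero_iff.2 hdet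
    have hrel : ∀ j : ℕ, j < n + 1 → ∑ i, derivative^[j] (f i) * g i = 0 := by
      intro j hj
      have := congrFun hg ⟨j, hj⟩
      simpa [Matrix.mulVec, dotProduct, wronskianMatrix] using this
    obtain ⟨k, hk⟩ := Function.ne_iff.1 hg0
    have hk : g k ≠ 0 := hk
    have hrel' : ∀ j : ℕ, j < n → ∑ i, derivative^[j] (f i) *
        (g k * derivative (g i) - derivative (g k) * g i) = 0 := by
      intro j hj
      have h1 := hrel j (by omega)
      have h2 := hrel (j + 1) (by omega)
      have h3 := congrArg derivative h1
      simp only [derivative_sum, derivative_mul, Finset.sum_add_distrib, derivative_zero,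
        ← Function.iterate_succ_apply' (derivative : K[X] → K[X])] at h3
      rw [h2, zero_add] at h3
      calc _ = g k * ∑ i, derivative^[j] (f i) * derivative (g i) -
            derivative (g k) * ∑ i, derivative^[j] (f i) * g i := by
            rw [Finset.mul_sum, Finset.mul_sum, ← Finset.sum_sub_distrib]
            exact Finset.sum_congr rfl fun i _ => by ring
        _ = 0 := by rw [h3, h1]; ring
    have hsub := ih (hf.comp k.succAbove k.succAbove_right_injective)
    have hv := Matrix.eq_zero_of_mulVec_eq_zero (M := wronskianMatrix (f ∘ k.succAbove))
      (v := fun i => g k * derivative (g (k.succAbove i)) -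
        derivative (g k) * g (k.succAbove i)) hsub (by
        ext1 j
        have := hrel' j j.2
        rw [Fin.sum_univ_succAbove _ k, mul_comm (g k), sub_self, mul_zero, zero_add] at this
        simpa [Matrix.mulVec, dotProduct, wronskianMatrix] using this)
    have hc : ∀ i, ∃ a : K, g i = C a * g k := by
      intro i
      rcases Fin.eq_self_or_eq_succAbove k i with rfl | ⟨i, rfl⟩
      · exact ⟨1, by simp⟩
      · exact exists_eq_C_mul_of_mul_derivative_eq hk (sub_eq_zero.1 (congrFun hv i))
    choose a ha using hc
    have h0 := hrel 0 (Nat.succ_pos n)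
    have h1 : (∑ i, a i • f i) * g k = 0 := by
      rw [← h0, Finset.sum_mul]
      refine Finset.sum_congr rfl fun i _ => ?_
      rw [ha i, smul_eq_C_mul, Function.iterate_zero_apply]
      ring
    have h2 := Fintype.linearIndependent_iff.1 hf a ((mul_eq_zero.1 h1).resolve_right hk) k
    apply hk
    rw [ha k, h2, C_0, zero_mul]

theorem exists_iterate_derivative_pow_eq (p : K[X]) {m n j : ℕ} (hj : j ≤ n) (hn : n ≤ m) :
    ∃ q : K[X], derivative^[j] (p ^ m) = p ^ (m - n) * q ∧ q.natDegree ≤ n * p.natDegree := by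
  obtain ⟨q, hq⟩ : p ^ (m - n) ∣ derivative^[j] (p ^ m) :=
    (pow_dvd_pow p (by omega)).trans (pow_sub_dvd_iterate_derivative_pow p m j)
  rcases eq_or_ne (derivative^[j] (p ^ m)) 0 with h0 | h0
  · exact ⟨0, by simp [h0], by simp⟩
  refine ⟨q, hq, ?_⟩
  have hpq := h0
  rw [hq] at hpq
  have h1 : (derivative^[j] (p ^ m)).natDegree ≤ m * p.natDegree :=
    (natDegree_iterate_derivative _ _).trans (by rw [natDegree_pow]; omega)
  rw [hq, natDegree_mul (left_ne_zero_of_mul hpq) (right_ne_zero_of_mul hpq), natDegree_pow] at h1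
  have : m * p.natDegree = (m - n) * p.natDegree + n * p.natDegree := by
    rw [← add_mul, Nat.sub_add_cancel hn]
  omega

/-- Fewer than `n` derivatives leave a factor `f i ^ (m - n)` in each column; what matters is that
the cofactor's degree bound is free of `m`. -/
theorem exists_det_wronskianMatrix_pow_eq {n m : ℕ} (f : Fin n → K[X]) (hn : n ≤ m) :
    ∃ Q : K[X], (wronskianMatrix fun i => f i ^ m).det = (∏ i, f i ^ (m - n)) * Q ∧
      Q.natDegree ≤ ∑ i, n * (f i).natDegree := by
  choose q hq hdeg using fun j i : Fin n => exists_iterate_derivative_pow_eq (f i) j.2.le hn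
  refine ⟨(Matrix.of q).det, ?_, ?_⟩
  · rw [← Matrix.det_mul_row]
    congr 1
    ext1 j i
    simp [wronskianMatrix, hq]
  · rw [Matrix.det_apply]
    refine natDegree_sum_le_of_forall_le _ _ fun σ _ => (natDegree_smul_le _ _).trans ?_
    exact (natDegree_prod_le _ _).trans (Finset.sum_le_sum fun i _ => hdeg _ _)

end Wronskian

/-! ### Independence of high powers. -/

section PowersIndependent

variable {K : Type*} [Field K] [CharZero K]

theorem dvd_of_forall_dvd_pow_mul {R ι : Type*} [CommRing R] {f : ι → R}
    (hf : Ideal.span (Set.range f) = ⊤) {e : ℕ} {a b : R} (h : ∀ i, a ∣ f i ^ e * b) : a ∣ b := by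
  have h1 : (1 : R) ∈ Ideal.span ((fun x => x ^ e) '' Set.range f) := by
    rw [Ideal.span_pow_eq_top _ hf]
    trivial
  suffices H : ∀ x ∈ Ideal.span ((fun x => x ^ e) '' Set.range f), a ∣ x * b by
    simpa using H 1 h1
  intro x hx
  induction hx using Submodule.span_induction with
  | mem x hx =>
    obtain ⟨_, ⟨i, rfl⟩, rfl⟩ := hx
    exact h i
  | zero => simp
  | add x y _ _ hx hy => rw [add_mul]; exact dvd_add hx hy
  | smul r x _ hx => rw [smul_eq_mul, mul_assoc]; exact hx.mul_left r

/-- A relation among high powers of polynomials without common factor, any proper subfamily of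
which is independent, involves only constants. -/
theorem natDegree_eq_zero_of_sum_smul_pow_eq_zero {n m : ℕ} (hm : n * n + n < m)
    {f : Fin (n + 1) → K[X]} (hf : Ideal.span (Set.range f) = ⊤) (hf0 : ∀ i, f i ≠ 0)
    (hind : ∀ p : Fin (n + 1), LinearIndependent K fun i => f (p.succAbove i) ^ m)
    {a : Fin (n + 1) → K} (ha : ∀ i, a i ≠ 0) (hsum : ∑ i, a i • f i ^ m = 0) (i : Fin (n + 1)) :
    (f i).natDegree = 0 := by
  obtain ⟨p, hp⟩ := Finite.exists_max fun i => (f i).natDegree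
  suffices H : (f p).natDegree = 0 from Nat.eq_zero_of_le_zero ((hp i).trans H.le)
  have hnm : n ≤ m := by nlinarith
  set g : Fin n → K[X] := fun i => f (p.succAbove i) with hg
  obtain ⟨Q, hQ, hQdeg⟩ := exists_det_wronskianMatrix_pow_eq g hnm
  have hW := det_wronskianMatrix_ne_zero (hind p)
  have hQ0 : Q ≠ 0 := by
    rintro rfl
    exact hW (hQ.trans (mul_zero _))
  set c : Fin n → K := fun i => -(a p)⁻¹ * a (p.succAbove i) with hc
  have hc0 : ∀ i, c i ≠ 0 := fun i => mul_ne_zero (neg_ne_zero.2 (inv_ne_zero (ha p))) (ha _)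
  have hfp : f p ^ m = ∑ i, c i • g i ^ m := by
    rw [Fin.sum_univ_succAbove _ p] at hsum
    simp only [hc, mul_smul, ← Finset.smul_sum]
    rw [← neg_eq_of_add_eq_zero_right hsum, neg_smul, smul_neg, neg_neg, inv_smul_smul₀ (ha p)]
  -- Replacing column `i` by that of `f p` only multiplies the Wronskian by `c i`, so `f p ^ (m -
  -- n)` divides `g i ^ (m - n) * Q` for each `i`. Having no common factor removes the `g i`.
  have hdvd : f p ^ (m - n) ∣ Q := by
    refine dvd_of_forall_dvd_pow_mul hf (e := m - n) fun i => ?_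
    rcases Fin.eq_self_or_eq_succAbove p i with rfl | ⟨i, rfl⟩
    · exact dvd_mul_right _ _
    obtain ⟨R, hR, -⟩ := exists_det_wronskianMatrix_pow_eq (Function.update g i (f p)) hnm
    have hcol : (wronskianMatrix fun j => Function.update g i (f p) j ^ m) =
        (wronskianMatrix fun j => g j ^ m).updateCol i
          (fun k => ∑ j, C (c j) • (wronskianMatrix fun j => g j ^ m) k j) := by
      ext1 k j
      rcases eq_or_ne j i with rfl | hji
      · simp only [wronskianMatrix, Matrix.of_apply, Function.update_self, Matrix.updateCol_self,
          hfp, iterate_derivative_sum, smul_eq_mul, smul_eq_C_mul,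
          iterate_derivative_C_mul]
      · simp [wronskianMatrix, hji]
    have hupd : ∏ j ∈ Finset.univ.erase i, Function.update g i (f p) j ^ (m - n) =
        ∏ j ∈ Finset.univ.erase i, g j ^ (m - n) :=
      Finset.prod_congr rfl fun j hj => by
        rw [Function.update_of_ne (Finset.ne_of_mem_erase hj)]
    rw [hcol, Matrix.det_updateCol_sum, hQ, smul_eq_mul,
      ← Finset.mul_prod_erase _ _ (Finset.mem_univ i),
      ← Finset.mul_prod_erase Finset.univ (fun j => Function.update g i (f p) j ^ (m - n))
        (Finset.mem_univ i), Function.update_self, hupd] at hR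
    have hprod : ∏ j ∈ Finset.univ.erase i, g j ^ (m - n) ≠ 0 :=
      Finset.prod_ne_zero_iff.2 fun j _ => pow_ne_zero _ (hf0 _)
    have hR' : C (c i) * (g i ^ (m - n) * Q) = f p ^ (m - n) * R :=
      mul_left_cancel₀ hprod (by linear_combination hR)
    exact (IsUnit.dvd_mul_left (isUnit_C.2 (hc0 i).isUnit)).1 ⟨R, hR'⟩
  have h1 := natDegree_le_of_dvd hdvd hQ0
  rw [natDegree_pow] at h1
  have h2 : ∑ i, n * (g i).natDegree ≤ n * n * (f p).natDegree := by
    calc _ ≤ ∑ _i : Fin n, n * (f p).natDegree :=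
          Finset.sum_le_sum fun i _ => Nat.mul_le_mul_left _ (hp _)
      _ = _ := by simp [mul_assoc]
  by_contra h0
  -- Maximality of the degree of `f p` bounds `Q`; the outcome `m - n ≤ n * n` contradicts `hm`.
  have h3 : (m - n) * (f p).natDegree ≤ n * n * (f p).natDegree := (h1.trans hQdeg).trans h2
  have h4 := Nat.le_of_mul_le_mul_right h3 (Nat.pos_of_ne_zero h0)
  omega

/-- By induction a relation has no zero coefficient. After division by the gcd it involves only
constants, and two constants are proportional. -/
theorem linearIndependent_pow_fin {n m : ℕ} (hm : n * n ≤ m) {f : Fin n → K[X]}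
    (hf0 : ∀ i, f i ≠ 0) (hf : ∀ i j, i ≠ j → ∀ a : K, f i ≠ C a * f j) :
    LinearIndependent K fun i => f i ^ m := by
  classical
  induction n with
  | zero => exact linearIndependent_empty_type
  | succ n ih =>
    rw [Fintype.linearIndependent_iff]
    intro a hsum
    by_contra! hne
    obtain ⟨i₀, hi₀⟩ := hne
    obtain ⟨h, hfh, hgcd⟩ := (Finset.univ : Finset (Fin (n + 1))).extract_gcd f ⟨0, by simp⟩
    set d := Finset.univ.gcd f
    have hfh : ∀ i, f i = d * h i := fun i => hfh i (Finset.mem_univ i)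
    have hd0 : d ≠ 0 := by
      intro h0
      exact hf0 0 (by rw [hfh, h0, zero_mul])
    have hh0 : ∀ i, h i ≠ 0 := by
      intro i h0
      exact hf0 i (by rw [hfh, h0, mul_zero])
    have hh : ∀ i j, i ≠ j → ∀ a : K, h i ≠ C a * h j := by
      intro i j hij a h0
      exact hf i j hij a (by rw [hfh i, hfh j, h0, mul_left_comm])
    have hind : ∀ p : Fin (n + 1), LinearIndependent K fun i => h (p.succAbove i) ^ m := by
      intro p
      exact ih (by nlinarith) (fun i => hh0 _)
        fun i j hij => hh _ _ (p.succAbove_right_injective.ne hij)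
    have hsum' : ∑ i, a i • h i ^ m = 0 := by
      apply mul_left_cancel₀ (pow_ne_zero m hd0)
      rw [mul_zero, ← hsum, Finset.mul_sum]
      exact Finset.sum_congr rfl fun i _ => by rw [hfh i, mul_pow, mul_smul_comm]
    have ha : ∀ i, a i ≠ 0 := by
      intro p hp
      rw [Fin.sum_univ_succAbove _ p, hp, zero_smul, zero_add] at hsum'
      have h0 := Fintype.linearIndependent_iff.1 (hind p) _ hsum'
      rcases Fin.eq_self_or_eq_succAbove p i₀ with rfl | ⟨i, rfl⟩
      · exact hi₀ hp
      · exact hi₀ (h0 i)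
    have htop : Ideal.span (Set.range h) = ⊤ := by
      obtain ⟨u, hu⟩ := IsPrincipalIdealRing.principal (Ideal.span (Set.range h))
      have hu : Ideal.span (Set.range h) = Ideal.span {u} := hu
      have h1 : u ∣ Finset.univ.gcd h := Finset.dvd_gcd fun i _ => by
        rw [← Ideal.mem_span_singleton, ← hu]
        exact Ideal.subset_span ⟨i, rfl⟩
      rw [hgcd] at h1
      rw [hu, Ideal.span_singleton_eq_top]
      exact isUnit_of_dvd_one h1
    have hdeg := natDegree_eq_zero_of_sum_smul_pow_eq_zero (by nlinarith) htop hh0 hind ha hsum'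
    cases n with
    | zero =>
      simp only [Fin.sum_univ_succ, Finset.univ_eq_empty, Finset.sum_empty, add_zero] at hsum'
      exact (smul_ne_zero (ha _) (pow_ne_zero m (hh0 _))) hsum'
    | succ n =>
      obtain ⟨u, hu⟩ := natDegree_eq_zero.1 (hdeg 0)
      obtain ⟨v, hv⟩ := natDegree_eq_zero.1 (hdeg 1)
      have hv0 : v ≠ 0 := by
        rintro rfl
        exact hh0 1 (by rw [← hv, C_0])
      exact hh 0 1 (by simp) (u / v) (by rw [← hu, ← hv, ← C_mul, div_mul_cancel₀ _ hv0])

/-- High powers of pairwise non-proportional polynomials are linearly independent. -/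
theorem linearIndependent_pow_of_pairwise_ne_C_mul {ι : Type*} [Fintype ι] {m : ℕ}
    (hm : Fintype.card ι * Fintype.card ι ≤ m) {f : ι → K[X]}
    (hf0 : ∀ i, f i ≠ 0) (hf : ∀ i j, i ≠ j → ∀ a : K, f i ≠ C a * f j) :
    LinearIndependent K fun i => f i ^ m := by
  rw [← linearIndependent_equiv (Fintype.equivFin ι).symm]
  exact linearIndependent_pow_fin hm (fun _ => hf0 _)
    fun i j hij => hf _ _ ((Fintype.equivFin ι).symm.injective.ne hij)

end PowersIndependent

/-! ### Divisors and extraction of `m`-th powers. -/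

section Multiplicities

variable {K : Type*} [Field K]

/-- The divisor of a polynomial, in multiplicative notation. -/
noncomputable def rootDivisor (p : K[X]) : Multiplicative (K → ℤ) :=
  Multiplicative.ofAdd fun a => (rootMultiplicity a p : ℤ)

theorem rootDivisor_prod {ι : Type*} (s : Finset ι) {f : ι → K[X]} (hf : ∀ i ∈ s, f i ≠ 0) :
    rootDivisor (∏ i ∈ s, f i) = ∏ i ∈ s, rootDivisor (f i) := by
  classical
  induction s using Finset.induction_on with
  | empty =>
    apply Multiplicative.toAdd.injective
    ext a
    simp [rootDivisor]
  | insert i s hi ih =>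
    have h0 : ∏ j ∈ s, f j ≠ 0 :=
      Finset.prod_ne_zero_iff.2 fun j hj => hf j (Finset.mem_insert_of_mem hj)
    rw [Finset.prod_insert hi, Finset.prod_insert hi,
      ← ih fun j hj => hf j (Finset.mem_insert_of_mem hj)]
    apply Multiplicative.toAdd.injective
    ext a
    simp [rootDivisor, rootMultiplicity_mul (mul_ne_zero (hf i (Finset.mem_insert_self i s)) h0)]

theorem eq_C_mul_prod_rootMultiplicity [IsAlgClosed K] [DecidableEq K] {p : K[X]} {U : Finset K}
    (hU : p.roots.toFinset ⊆ U) :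
    p = C p.leadingCoeff * ∏ a ∈ U, (X - C a) ^ rootMultiplicity a p := by
  conv_lhs => rw [(IsAlgClosed.splits p).eq_prod_roots]
  rw [Finset.prod_multiset_map_count]
  congr 1
  simp only [count_roots]
  refine Finset.prod_subset hU fun a _ ha => ?_
  rw [Multiset.mem_toFinset, ← Multiset.count_eq_zero, count_roots] at ha
  rw [ha, pow_zero]

theorem eq_C_mul_of_rootDivisor_eq [IsAlgClosed K] {p q : K[X]} (hq : q ≠ 0)
    (h : rootDivisor p = rootDivisor q) : p = C (p.leadingCoeff / q.leadingCoeff) * q := by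
  classical
  have h' : ∀ a, rootMultiplicity a p = rootMultiplicity a q := fun a => by
    exact_mod_cast congrFun (Multiplicative.ofAdd.injective h) a
  have hp := eq_C_mul_prod_rootMultiplicity (p := p)
    (Finset.subset_union_left (s₂ := q.roots.toFinset))
  have hq' := eq_C_mul_prod_rootMultiplicity (p := q)
    (Finset.subset_union_right (s₁ := p.roots.toFinset))
  calc p = C p.leadingCoeff * ∏ a ∈ p.roots.toFinset ∪ q.roots.toFinset,
          (X - C a) ^ rootMultiplicity a p := hp
    _ = C (p.leadingCoeff / q.leadingCoeff) * (C q.leadingCoeff *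
          ∏ a ∈ p.roots.toFinset ∪ q.roots.toFinset, (X - C a) ^ rootMultiplicity a q) := by
        rw [← mul_assoc, ← C_mul, div_mul_cancel₀ _ (leadingCoeff_ne_zero.2 hq)]
        simp only [h']
    _ = _ := by rw [← hq']

/-- Polynomials whose divisors agree modulo `m` are constants times `m`-th powers times a common
factor. -/
theorem exists_eq_C_mul_mul_pow [IsAlgClosed K] (q : K[X]) (m : ℕ) :
    ∃ g : K[X], g ≠ 0 ∧ ∀ p : K[X], (∃ r, rootDivisor p = rootDivisor q * r ^ m) →
      ∃ r, p = C p.leadingCoeff * (g * r ^ m) := by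
  classical
  -- The common factor carries the residues of the multiplicities modulo `m`; the quotients go into
  -- `r`.
  refine ⟨∏ a ∈ q.roots.toFinset, (X - C a) ^ (rootMultiplicity a q % m),
    Finset.prod_ne_zero_iff.2 fun a _ => pow_ne_zero _ (X_sub_C_ne_zero a), ?_⟩
  rintro p ⟨r, hr⟩
  have hmod : ∀ a, rootMultiplicity a p % m = rootMultiplicity a q % m := by
    intro a
    have h1 : (rootMultiplicity a p : ℤ) = rootMultiplicity a q + m * (Multiplicative.toAdd r a) := by
      have := congrFun (congrArg Multiplicative.toAdd hr) a
      simpa [rootDivisor] using this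
    have h2 : (rootMultiplicity a p : ℤ) % m = (rootMultiplicity a q : ℤ) % m := by
      rw [h1, Int.add_mul_emod_self_left]
    exact_mod_cast h2
  refine ⟨∏ a ∈ p.roots.toFinset ∪ q.roots.toFinset, (X - C a) ^ (rootMultiplicity a p / m), ?_⟩
  conv_lhs => rw [eq_C_mul_prod_rootMultiplicity (p := p)
    (Finset.subset_union_left (s₂ := q.roots.toFinset))]
  congr 1
  have hg : ∏ a ∈ q.roots.toFinset, (X - C a) ^ (rootMultiplicity a q % m) =
      ∏ a ∈ p.roots.toFinset ∪ q.roots.toFinset, (X - C a) ^ (rootMultiplicity a p % m) := by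
    simp only [hmod]
    refine Finset.prod_subset Finset.subset_union_right fun a _ ha => ?_
    rw [Multiset.mem_toFinset, ← Multiset.count_eq_zero, count_roots] at ha
    rw [ha, Nat.zero_mod, pow_zero]
  rw [hg, ← Finset.prod_pow, ← Finset.prod_mul_distrib]
  refine Finset.prod_congr rfl fun a _ => ?_
  rw [← pow_mul, ← pow_add, Nat.mod_add_div']

end Multiplicities

/-! ### From independence to distinct subset sums. -/

section Sums

theorem NoScalarMultiples.ne_C_mul {S : Finset ℂ[X]} (hS : NoScalarMultiples S) {p q : ℂ[X]}
    (hp : p ∈ S) (hq : q ∈ S) (hpq : p ≠ q) (a : ℂ) : p ≠ C a * q := by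
  rw [← smul_eq_C_mul]
  exact hS p hp q hq hpq a

theorem NoScalarMultiples.mono {S T : Finset ℂ[X]} (hS : NoScalarMultiples S) (h : T ⊆ S) :
    NoScalarMultiples T :=
  fun p hp q hq => hS p (h hp) q (h hq)

theorem NoScalarMultiples.zero_notMem {S : Finset ℂ[X]} (hS : NoScalarMultiples S)
    (hcard : 2 ≤ S.card) : (0 : ℂ[X]) ∉ S := by
  intro h0
  obtain ⟨q, hq, hq0⟩ := Finset.exists_mem_ne hcard 0
  exact hS 0 h0 q hq hq0.symm 0 (zero_smul _ _).symm

theorem linearIndependent_of_eq_C_mul_mul_pow {T : Finset ℂ[X]} (hT : NoScalarMultiples T)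
    (hT0 : (0 : ℂ[X]) ∉ T) {m : ℕ} (hm : T.card * T.card ≤ m) {g : ℂ[X]} (hg : g ≠ 0)
    (hr : ∀ p ∈ T, ∃ r, p = C p.leadingCoeff * (g * r ^ m)) :
    LinearIndependent ℂ (fun p : T => (p : ℂ[X])) := by
  have hne : ∀ p : T, (p : ℂ[X]) ≠ 0 := fun p h => hT0 (h ▸ p.2)
  choose r hr using fun p : T => hr p p.2
  have hlc : ∀ p : T, (p : ℂ[X]).leadingCoeff ≠ 0 := fun p => leadingCoeff_ne_zero.2 (hne p)
  have hm0 : ∀ p : T, m ≠ 0 := fun p => by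
    have := Finset.card_pos.2 ⟨_, p.2⟩
    have := Nat.mul_pos this this
    omega
  have hind : LinearIndependent ℂ fun p : T => r p ^ m := by
    refine linearIndependent_pow_of_pairwise_ne_C_mul (by simpa using hm) ?_ ?_
    · intro p h0
      apply hne p
      rw [hr p, h0, zero_pow (hm0 p), mul_zero, mul_zero]
    · intro p q hpq a h0
      refine hT.ne_C_mul p.2 q.2 (Subtype.coe_injective.ne hpq)
        ((p : ℂ[X]).leadingCoeff * a ^ m / (q : ℂ[X]).leadingCoeff) ?_
      calc (p : ℂ[X]) = C (p : ℂ[X]).leadingCoeff * (g * r p ^ m) := hr p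
        _ = C ((p : ℂ[X]).leadingCoeff * a ^ m / (q : ℂ[X]).leadingCoeff) *
            (C (q : ℂ[X]).leadingCoeff * (g * r q ^ m)) := by
          rw [← mul_assoc (C (_ / _)), ← C_mul, div_mul_cancel₀ _ (hlc q), h0, mul_pow, C_mul,
            C_pow]
          ring
        _ = _ := by rw [← hr q]
  rw [Fintype.linearIndependent_iff] at hind ⊢
  intro a ha p
  refine (mul_eq_zero.1 (hind (fun p => a p * (p : ℂ[X]).leadingCoeff) ?_ p)).resolve_right (hlc p)
  apply mul_left_cancel₀ hg
  rw [mul_zero, ← ha, Finset.mul_sum]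
  refine Finset.sum_congr rfl fun p _ => ?_
  conv_rhs => rw [hr p]
  rw [smul_eq_C_mul, smul_eq_C_mul, C_mul]
  ring

theorem mem_prodSet {R : Type*} [CommRing R] {S : Finset R} {l : ℕ} {p : R} :
    p ∈ prodSet l S ↔ ∃ s : Fin l → R, (∀ i, s i ∈ S) ∧ ∏ i, s i = p := by
  simp [prodSet]

theorem mem_sumSet {R : Type*} [CommRing R] {S : Finset R} {k : ℕ} {p : R} :
    p ∈ sumSet k S ↔ ∃ s : Fin k → R, (∀ i, s i ∈ S) ∧ ∑ i, s i = p := by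
  simp [sumSet]

open Classical in
/-- If all small subsets of `S` are linearly independent, sums over distinct `k`-subsets of `S`
are distinct. -/
theorem choose_card_le_card_sumSet {S T : Finset ℂ[X]} {k : ℕ} (hTS : T ⊆ S)
    (hT : ∀ U ⊆ T, U.card ≤ 2 * k → LinearIndependent ℂ (fun p : U => (p : ℂ[X]))) :
    T.card.choose k ≤ (sumSet k S).card := by
  rw [← Finset.card_powersetCard]
  refine Finset.card_le_card_of_injOn (fun A => ∑ p ∈ A, p) ?_ ?_
  · intro A hA
    obtain ⟨hAT, hAk⟩ := Finset.mem_powersetCard.1 hA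
    refine mem_sumSet.2 ⟨fun i => ((A.equivFinOfCardEq hAk).symm i : ℂ[X]), ?_, ?_⟩
    · exact fun i => hTS (hAT ((A.equivFinOfCardEq hAk).symm i).2)
    · exact (Equiv.sum_comp (A.equivFinOfCardEq hAk).symm (fun p : A => (p : ℂ[X]))).trans <|
        Finset.sum_coe_sort A fun p => p
  · intro A hA B hB hAB
    obtain ⟨hAT, hAk⟩ := Finset.mem_powersetCard.1 hA
    obtain ⟨hBT, hBk⟩ := Finset.mem_powersetCard.1 hB
    have hind := hT (A ∪ B) (Finset.union_subset hAT hBT)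
      ((Finset.card_union_le A B).trans (by omega))
    have hsum : ∀ V ⊆ A ∪ B, ∑ p : ↥(A ∪ B), (if (p : ℂ[X]) ∈ V then (1 : ℂ) else 0) • (p : ℂ[X]) =
        ∑ p ∈ V, p := by
      intro V hV
      rw [Finset.sum_coe_sort (A ∪ B) fun p => (if p ∈ V then (1 : ℂ) else 0) • p]
      simp only [ite_smul, one_smul, zero_smul]
      rw [Finset.sum_ite_mem, Finset.inter_eq_right.2 hV]
    -- Equal sums make the difference of the two indicator functions a relation on `A ∪ B`.
    have hz := Fintype.linearIndependent_iff.1 hind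
      (fun p => (if (p : ℂ[X]) ∈ A then (1 : ℂ) else 0) - if (p : ℂ[X]) ∈ B then (1 : ℂ) else 0) (by
        simp only [sub_smul, Finset.sum_sub_distrib]
        rw [hsum A Finset.subset_union_left, hsum B Finset.subset_union_right]
        exact sub_eq_zero.2 hAB)
    ext p
    by_cases hp : p ∈ A ∪ B
    · have := hz ⟨p, hp⟩
      by_cases hpA : p ∈ A <;> by_cases hpB : p ∈ B <;> simp_all
    · rw [Finset.mem_union, not_or] at hp
      exact iff_of_false hp.1 hp.2

end Sums

/-! ### The quantitative bound and the theorem. -/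

section SumProduct

open Classical in
/-- If the product sets of `S` grow slowly, a large subset of `S` consists of constants times
`m`-th powers times a common factor. -/
theorem exists_subset_eq_C_mul_mul_pow {S : Finset ℂ[X]} (hS : NoScalarMultiples S)
    (hcard : 2 ≤ S.card) {m J l : ℕ} {c : ℝ} (hm : 1 ≤ m) (hJ : 1 ≤ J) (hl : (m + 1) ^ J ≤ l)
    (h : ((prodSet l S).card : ℝ) < (S.card : ℝ) ^ c) :
    ∃ T ⊆ S, (S.card : ℝ) ^ (1 - c / J) ≤ (T.card : ℝ) ∧
      ∃ g : ℂ[X], g ≠ 0 ∧ ∀ p ∈ T, ∃ r, p = C p.leadingCoeff * (g * r ^ m) := by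
  have hS0 := hS.zero_notMem hcard
  have hne : ∀ p ∈ S, p ≠ 0 := fun p hp h0 => hS0 (h0 ▸ hp)
  have hinj : Set.InjOn (rootDivisor : ℂ[X] → _) S := by
    intro p hp q hq hpq
    by_contra hpq'
    exact hS.ne_C_mul hp hq hpq' _ (eq_C_mul_of_rootDivisor_eq (hne q hq) hpq)
  have hA : (S.image rootDivisor).card = S.card := Finset.card_image_of_injOn hinj
  have hAne : (S.image rootDivisor).Nonempty := by
    rw [← Finset.card_pos, hA]
    omega
  open scoped Pointwise in
  have hpow : (S.image rootDivisor) ^ l ⊆ (prodSet l S).image rootDivisor := by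
    intro x hx
    obtain ⟨f, rfl⟩ := Finset.mem_pow.1 hx
    choose s hsS hs using fun i => Finset.mem_image.1 (f i).2
    refine Finset.mem_image.2 ⟨∏ i, s i, mem_prodSet.2 ⟨s, hsS, rfl⟩, ?_⟩
    rw [rootDivisor_prod _ fun i _ => hne _ (hsS i), List.prod_ofFn]
    exact Finset.prod_congr rfl fun i _ => hs i
  have hlt := (Nat.cast_le (α := ℝ)).2 ((Finset.card_le_card hpow).trans Finset.card_image_le)
  obtain ⟨B, hBA, hBcard, hB⟩ := exists_subset_eq_mul_pow hAne hm hJ hl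
    (hlt.trans_lt (by rwa [hA]))
  have hBimage : (S.filter fun p => rootDivisor p ∈ B).image rootDivisor = B := by
    ext x
    simp only [Finset.mem_image, Finset.mem_filter]
    constructor
    · rintro ⟨p, ⟨-, hp⟩, rfl⟩
      exact hp
    · intro hx
      obtain ⟨p, hp, rfl⟩ := Finset.mem_image.1 (hBA hx)
      exact ⟨p, ⟨hp, hx⟩, rfl⟩
  have hTcard : B.card ≤ (S.filter fun p => rootDivisor p ∈ B).card := by
    conv_lhs => rw [← hBimage]
    exact Finset.card_image_le
  rw [hA] at hBcard
  have hle := hBcard.trans (Nat.cast_le.2 hTcard)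
  have hpos : (0 : ℝ) < (S.card : ℝ) ^ (1 - c / J) := Real.rpow_pos_of_pos (by positivity) _
  obtain ⟨q, hq⟩ : (S.filter fun p => rootDivisor p ∈ B).Nonempty := by
    rw [← Finset.card_pos]
    exact_mod_cast hpos.trans_le hle
  obtain ⟨g, hg, hgr⟩ := exists_eq_C_mul_mul_pow q m
  refine ⟨_, Finset.filter_subset _ _, hle, g, hg, fun p hp => hgr p ?_⟩
  exact hB _ (Finset.mem_filter.1 hp).2 _ (Finset.mem_filter.1 hq).2

theorem sumSet_nonempty {R : Type*} [CommRing R] {S : Finset R} (hS : S.Nonempty) (k : ℕ) :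
    (sumSet k S).Nonempty := by
  obtain ⟨p, hp⟩ := hS
  exact ⟨_, mem_sumSet.2 ⟨fun _ => p, fun _ => hp, rfl⟩⟩

theorem pow_div_le_choose {t k : ℕ} (h : 2 * k ≤ t) :
    (t : ℝ) ^ k / (2 ^ k * k.factorial) ≤ (t.choose k : ℝ) := by
  refine le_trans ?_ (Nat.pow_le_choose k t)
  rw [← div_div, ← div_pow]
  have h1 : (t : ℝ) / 2 ≤ ((t + 1 - k : ℕ) : ℝ) := by
    rw [div_le_iff₀ two_pos]
    exact_mod_cast (by omega : t ≤ (t + 1 - k) * 2)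
  gcongr

/-- Slowly growing product sets force `|kS|` to be nearly as large as `|S| ^ k`. -/
theorem rpow_lt_card_sumSet {S : Finset ℂ[X]} (hS : NoScalarMultiples S) {k J l : ℕ} {c : ℝ}
    (hk : 1 ≤ k) (hJ : 1 ≤ J) (hl : (2 * k * (2 * k) + 1) ^ J ≤ l)
    (h : ((prodSet l S).card : ℝ) < (S.card : ℝ) ^ c) (hcJ : c / J ≤ 1 / 2)
    (hcard : (2 * k) ^ 2 ≤ S.card)
    (hbig : (2 ^ k * k.factorial : ℝ) < (S.card : ℝ) ^ (k * (c / J))) :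
    (S.card : ℝ) ^ (k - 2 * k * (c / J)) < ((sumSet k S).card : ℝ) := by
  have hcard2 : 2 ≤ S.card := by nlinarith
  have hn : (1 : ℝ) ≤ S.card := by exact_mod_cast (by omega : 1 ≤ S.card)
  have hn0 : (0 : ℝ) < S.card := by linarith
  obtain ⟨T, hTS, hTcard, g, hg, hr⟩ :=
    exists_subset_eq_C_mul_mul_pow hS hcard2 (m := 2 * k * (2 * k)) (by nlinarith) hJ hl h
  have h2k : 2 * k ≤ T.card := by
    have h1 : ((2 * k : ℕ) : ℝ) ≤ (S.card : ℝ) ^ (1 / 2 : ℝ) := by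
      rw [← Real.sqrt_eq_rpow]
      exact Real.le_sqrt_of_sq_le (by exact_mod_cast hcard)
    have h2 : (S.card : ℝ) ^ (1 / 2 : ℝ) ≤ (S.card : ℝ) ^ (1 - c / J) :=
      Real.rpow_le_rpow_of_exponent_le hn (by linarith)
    exact_mod_cast h1.trans (h2.trans hTcard)
  have hT : ∀ U ⊆ T, U.card ≤ 2 * k → LinearIndependent ℂ (fun p : U => (p : ℂ[X])) := by
    intro U hU hUk
    exact linearIndependent_of_eq_C_mul_mul_pow (hS.mono (hU.trans hTS))
      (fun h0 => hS.zero_notMem hcard2 (hTS (hU h0))) (Nat.mul_le_mul hUk hUk) hg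
      fun p hp => hr p (hU hp)
  -- Passing to `T` costs `k * (c / J)` in the exponent, and absorbing `2 ^ k * k!` through `hbig`
  -- costs the same again.
  have hpos : (0 : ℝ) < 2 ^ k * k.factorial := by positivity
  calc (S.card : ℝ) ^ (k - 2 * k * (c / J))
      = ((S.card : ℝ) ^ (1 - c / J)) ^ k / (S.card : ℝ) ^ (k * (c / J)) := by
        rw [← Real.rpow_natCast, ← Real.rpow_mul hn0.le, ← Real.rpow_sub hn0]
        ring_nf
    _ < ((S.card : ℝ) ^ (1 - c / J)) ^ k / (2 ^ k * k.factorial) := by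
        gcongr
    _ ≤ (T.card : ℝ) ^ k / (2 ^ k * k.factorial) := by gcongr
    _ ≤ (T.card.choose k : ℝ) := pow_div_le_choose h2k
    _ ≤ _ := by exact_mod_cast choose_card_le_card_sumSet hTS hT

end SumProduct

theorem theorem3 :
    ∃ f : ℝ → ℕ → ℕ → ℝ,
      (∀ (c : ℝ) (k : ℕ), 1 ≤ c → 1 ≤ k → Tendsto (fun l : ℕ => f c k l) atTop (𝓝 0)) ∧
      ∀ (c : ℝ) (k l : ℕ), 1 ≤ c → 1 ≤ k → 1 ≤ l →
        ∃ N : ℕ, ∀ n : ℕ, N ≤ n →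
          ∀ S : Finset ℂ[X], S.card = n → NoScalarMultiples S →
            ((prodSet l S).card : ℝ) < (n : ℝ) ^ c →
              (n : ℝ) ^ ((k : ℝ) - f c k l) < ((sumSet k S).card : ℝ) := by
  -- The logarithm is the largest `J` with `(m + 1) ^ J ≤ l`. The `+ 1` avoids a zero denominator,
  -- and `4` replaces `2` since `2 / J ≤ 4 / (J + 1)` for `J ≥ 1`.
  refine ⟨fun c k l => 4 * k * c / (Nat.log (2 * k * (2 * k) + 1) l + 1), ?_, ?_⟩
  · intro c k _ hk
    have hb : 1 < 2 * k * (2 * k) + 1 := by nlinarith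
    have hlog : Tendsto (fun l : ℕ => Nat.log (2 * k * (2 * k) + 1) l) atTop atTop := by
      refine tendsto_atTop.2 fun b => ?_
      filter_upwards [eventually_ge_atTop ((2 * k * (2 * k) + 1) ^ b)] with l hl
      exact Nat.le_log_of_pow_le hb hl
    exact Tendsto.div_atTop tendsto_const_nhds
      (tendsto_atTop_add_const_right _ _ (tendsto_natCast_atTop_atTop.comp hlog))
  intro c k l hc hk hl
  set J := Nat.log (2 * k * (2 * k) + 1) l
  have hk' : (1 : ℝ) ≤ k := by exact_mod_cast hk
  -- For small `l` the exponent may be negative, and a nonempty sumset suffices; otherwise `J + 1 ≥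
  -- 4 * c`.
  by_cases hneg : (k : ℝ) - 4 * k * c / (J + 1) < 0
  · refine ⟨2, fun n hn S hS _ _ => ?_⟩
    have h1 : 1 ≤ (sumSet k S).card :=
      (sumSet_nonempty (Finset.card_pos.1 (by omega)) k).card_pos
    have h2 : (1 : ℝ) < n := by exact_mod_cast (by omega : 1 < n)
    exact (Real.rpow_lt_one_of_one_lt_of_neg h2 hneg).trans_le (by exact_mod_cast h1)
  have hle : 4 * c ≤ J + 1 := by
    have h1 : 4 * k * c / (J + 1) ≤ (k : ℝ) := by linarith
    rw [div_le_iff₀ (by positivity)] at h1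
    nlinarith
  have hJ1 : 1 ≤ J := by
    have : (0 : ℝ) < J := by linarith
    exact_mod_cast this
  have hJ1' : (1 : ℝ) ≤ J := by exact_mod_cast hJ1
  have hcJ : 2 * (c / J) ≤ 4 * c / (J + 1) := by
    rw [← mul_div_assoc, div_le_div_iff₀ (by linarith) (by linarith)]
    nlinarith
  have hcJ' : c / J ≤ 1 / 2 := by
    have : 4 * c / (J + 1) ≤ 1 := (div_le_one (by linarith)).2 hle
    linarith
  have hexp : (0 : ℝ) < k * (c / J) := by positivity
  obtain ⟨N, hN⟩ := eventually_atTop.1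
    (((tendsto_rpow_atTop hexp).comp tendsto_natCast_atTop_atTop).eventually_gt_atTop
      (2 ^ k * k.factorial : ℝ))
  refine ⟨max N ((2 * k) ^ 2), fun n hn S hSn hS hprod => ?_⟩
  subst hSn
  have hcard := (le_max_right _ _).trans hn
  refine lt_of_le_of_lt ?_ (rpow_lt_card_sumSet hS hk hJ1 (Nat.pow_log_le_self _ (by omega)) hprod
    hcJ' hcard (hN _ ((le_max_left _ _).trans hn)))
  refine Real.rpow_le_rpow_of_exponent_le ?_ ?_
  · exact_mod_cast (by nlinarith : 1 ≤ S.card)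
  · have : k * (2 * (c / J)) ≤ k * (4 * c / (J + 1)) := by gcongr
    have h2 : (4 * k * c / (J + 1) : ℝ) = k * (4 * c / (J + 1)) := by ring
    change (k : ℝ) - 4 * k * c / (J + 1) ≤ _
    rw [h2]
    linarith
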